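/- Let $\mathbb{K}$ be $\mathbb{R}$ or $\mathbb{C}$. For a Banach space $E\neq 0$ over $\mathbb{K}$, with unit sphere $S_E$, dual $E^*$ and algebra $L(E)$ of bounded linear operators, the numerical radius of $T\in L(E)$ is $v(T)=\sup\{|x^*(Tx)| : x\in S_E,\ x^*\in S_{E^*},\ x^*(x)=1\}$, and the numerical index of $E$ is $n(E)=\inf\{v(T) : T\in L(E),\ \|T\|=1\}$. For a compact Hausdorff space $K$, a closed subspace $Z$ of $C(K)$ is called C-rich if for every nonempty open $U\subseteq K$ and every $\varepsilon>0$ there is a nonnegative function $h\in C(K)$ of norm $1$ with support inside $U$ whose distance to $Z$ is less than $\varepsilon$. A subspace of a Banach space $E$ is an L-summand if it is the range of a bounded linear projection $P$ on $E$ with $\|x\|=\|Px\|+\|x-Px\|$ for all $x\in E$. Let $c$ be the space of convergent sequences in $\mathbb{K}$ with the supremum norm, and let $$X=\{(x,y,z)\in c\oplus_\infty c\oplus_\infty c : \lim x+\lim y+\lim z=0\},$$ $$Y=\{(x,y,z)\in X : \lim x=\lim y=\lim z=0\},\qquad H=\{(a,b,c)\in \ell_\infty^{(3)} : a+b+c=0\}.$$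 Then: 1. $X$ is a Banach space with $n(X)=1$ and $n(X^*)<1$. 2. $X$ is C-rich, when $c\oplus_\infty c\oplus_\infty c$ is identified isometrically with $C(K)$, where $K$ is the topological sum of three copies of $\mathbb{N}\cup\{\infty\}$ (the one-point compactification of $\mathbb{N}$), by $(x,y,z)(n)=x(n)$, $y(n)$, $z(n)$ on the first, second, third copy of $\mathbb{N}$. 3. The annihilator $Y^\perp\subseteq X^*$ is an L-summand of $X^*$, and $(X/Y)^*$ is isometrically isomorphic to $Y^\perp$ through $g\mapsto (x\mapsto g(x+Y))$. 4. The map $(x,y,z)+Y\mapsto(\lim x,\lim y,\lim z)$ is a well-defined isometric isomorphism of $X/Y$ onto $H$. The space $H$ has dimension $2$, and for $\mathbb{K}=\mathbb{R}$ its unit ball is a hexagon: its extreme points are exactly $\pm(1,-1,0)$, $\pm(1,0,-1)$, $\pm(0,1,-1)$. 5. $n(H)<1$. -/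

import Mathlib

open Filter Topology
open scoped BoundedContinuousFunction

namespace NumericalIndex

noncomputable section

section General

variable (𝕜 : Type*) [RCLike 𝕜] {E : Type*} [NormedAddCommGroup E] [NormedSpace 𝕜 E]

/-- The spatial numerical range
`V(T) = {f (T x) : ‖x‖ = 1, ‖f‖ = 1, f x = 1}` of a bounded operator `T`. -/
def numericalRange (T : E →L[𝕜] E) : Set 𝕜 :=
  {w | ∃ (x : E) (f : StrongDual 𝕜 E), ‖x‖ = 1 ∧ ‖f‖ = 1 ∧ f x = 1 ∧ f (T x) = w}

/-- The numerical radius `v(T) = sup {|w| : w ∈ V(T)}`. -/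
def numericalRadius (T : E →L[𝕜] E) : ℝ :=
  sSup ((fun w : 𝕜 => ‖w‖) '' numericalRange 𝕜 T)

variable (E) in
/-- The numerical index `n(E) = inf {v(T) : T ∈ L(E), ‖T‖ = 1}` of a (nonzero) normed space. -/
def numericalIndex : ℝ :=
  sInf (numericalRadius 𝕜 '' {T : E →L[𝕜] E | ‖T‖ = 1})

variable {𝕜}

/-- The annihilator `Yᗮ ⊆ E*` of a subspace `Y` of `E`. -/
def annihilator (Y : Submodule 𝕜 E) : Submodule 𝕜 (StrongDual 𝕜 E) where
  carrier := {f | ∀ y ∈ Y, f y = 0}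
  add_mem' := by
    intro f g hf hg y hy
    simp [hf y hy, hg y hy]
  zero_mem' := by
    intro y _
    simp
  smul_mem' := by
    intro a f hf y hy
    simp [hf y hy]

/-- A subspace `L` of `E` is an L-summand if it is the range of a bounded linear projection `P`
with `‖x‖ = ‖P x‖ + ‖x - P x‖` for all `x`. -/
def IsLSummand (L : Submodule 𝕜 E) : Prop :=
  ∃ P : E →L[𝕜] E, IsLprojection E P ∧ LinearMap.range (P : E →ₗ[𝕜] E) = L

/-- A subspace `X` of `C(K)` is C-rich if it is closed and for every nonempty open `U ⊆ K` and
every `ε > 0` there is a nonnegative function `h` of norm one, with support inside `U`, whose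
distance to `X` is less than `ε`. -/
def IsCRich {K : Type*} [TopologicalSpace K] [CompactSpace K] [T2Space K]
    (X : Submodule 𝕜 C(K, 𝕜)) : Prop :=
  IsClosed (X : Set C(K, 𝕜)) ∧
    ∀ U : Set K, IsOpen U → U.Nonempty → ∀ ε : ℝ, 0 < ε →
      ∃ h : C(K, 𝕜), (∀ t, ∃ r : ℝ, 0 ≤ r ∧ h t = (r : 𝕜)) ∧ ‖h‖ = 1 ∧
        tsupport (h : K → 𝕜) ⊆ U ∧ Metric.infDist h (X : Set C(K, 𝕜)) < ε

end General

section Example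

variable (𝕜 : Type*) [RCLike 𝕜]

/-- The subspace of convergent sequences in the space of all bounded scalar sequences. -/
def convSubmodule : Submodule 𝕜 (ℕ →ᵇ 𝕜) where
  carrier := {x | ∃ l : 𝕜, Tendsto (fun n => x n) atTop (𝓝 l)}
  add_mem' := by
    rintro x y ⟨a, ha⟩ ⟨b, hb⟩
    exact ⟨a + b, ha.add hb⟩
  zero_mem' := ⟨0, tendsto_const_nhds⟩
  smul_mem' := by
    rintro r x ⟨a, ha⟩
    exact ⟨r • a, ha.const_smul r⟩

/-- The space `c` of convergent scalar sequences, with the supremum norm. -/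
def ConvSeq : Type _ := convSubmodule 𝕜

instance : NormedAddCommGroup (ConvSeq 𝕜) :=
  inferInstanceAs (NormedAddCommGroup (convSubmodule 𝕜))

instance : NormedSpace 𝕜 (ConvSeq 𝕜) :=
  inferInstanceAs (NormedSpace 𝕜 (convSubmodule 𝕜))

variable {𝕜}

/-- The limit of a convergent sequence. -/
def seqLim (x : ConvSeq 𝕜) : 𝕜 := limUnder atTop (fun n => x.1 n)

theorem tendsto_seqLim (x : ConvSeq 𝕜) :
    Tendsto (fun n => x.1 n) atTop (𝓝 (seqLim x)) :=
  tendsto_nhds_limUnder x.2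

theorem seqLim_add (x y : ConvSeq 𝕜) : seqLim (x + y) = seqLim x + seqLim y :=
  tendsto_nhds_unique (tendsto_seqLim (x + y)) ((tendsto_seqLim x).add (tendsto_seqLim y))

theorem seqLim_smul (r : 𝕜) (x : ConvSeq 𝕜) : seqLim (r • x) = r * seqLim x :=
  tendsto_nhds_unique (tendsto_seqLim (r • x)) ((tendsto_seqLim x).const_smul r)

theorem norm_seqLim_le (x : ConvSeq 𝕜) : ‖seqLim x‖ ≤ 1 * ‖x‖ := by
  rw [one_mul]
  exact le_of_tendsto (tendsto_seqLim x).norm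
    (Eventually.of_forall fun n => x.1.norm_coe_le_norm n)

variable (𝕜)

/-- The limit, as a continuous linear functional on `c`. -/
def seqLimL : ConvSeq 𝕜 →L[𝕜] 𝕜 :=
  LinearMap.mkContinuous
    { toFun := seqLim
      map_add' := seqLim_add
      map_smul' := seqLim_smul } 1 norm_seqLim_le

/-- The subspace of all `(x, y, z)` in `c ⊕∞ c ⊕∞ c` with `lim x + lim y + lim z = 0`; the norm
of Mathlib's binary product is the maximum norm. -/
def subspaceX : Submodule 𝕜 (ConvSeq 𝕜 × ConvSeq 𝕜 × ConvSeq 𝕜) where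
  carrier := {p | seqLimL 𝕜 p.1 + seqLimL 𝕜 p.2.1 + seqLimL 𝕜 p.2.2 = 0}
  add_mem' := by
    intro p q hp hq
    simp only [Set.mem_ofPred_eq, Prod.fst_add, Prod.snd_add, map_add] at hp hq ⊢
    linear_combination hp + hq
  zero_mem' := by simp
  smul_mem' := by
    intro r p hp
    simp only [Set.mem_ofPred_eq, Prod.smul_fst, Prod.smul_snd, map_smul, smul_eq_mul] at hp ⊢
    linear_combination r * hp

/-- The space `X` of all `(x, y, z)` in `c ⊕∞ c ⊕∞ c` with `lim x + lim y + lim z = 0`, as a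
normed space in its own right. -/
def SpaceX : Type _ := subspaceX 𝕜

instance : NormedAddCommGroup (SpaceX 𝕜) :=
  inferInstanceAs (NormedAddCommGroup (subspaceX 𝕜))

instance : NormedSpace 𝕜 (SpaceX 𝕜) :=
  inferInstanceAs (NormedSpace 𝕜 (subspaceX 𝕜))

/-- The inclusion of `X` into `c ⊕∞ c ⊕∞ c`. -/
def inclX : SpaceX 𝕜 →L[𝕜] ConvSeq 𝕜 × ConvSeq 𝕜 × ConvSeq 𝕜 := (subspaceX 𝕜).subtypeL

/-- The subspace `Y` of `X` of all triples with `lim x = lim y = lim z = 0`. -/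
def spaceY : Submodule 𝕜 (SpaceX 𝕜) where
  carrier := {p | seqLimL 𝕜 (inclX 𝕜 p).1 = 0 ∧ seqLimL 𝕜 (inclX 𝕜 p).2.1 = 0 ∧ seqLimL 𝕜 (inclX 𝕜 p).2.2 = 0}
  add_mem' := by
    rintro p q ⟨h1, h2, h3⟩ ⟨k1, k2, k3⟩
    simp [h1, h2, h3, k1, k2, k3]
  zero_mem' := by simp
  smul_mem' := by
    rintro r p ⟨h1, h2, h3⟩
    simp [h1, h2, h3]

/-- `Y` is closed, so that `X ⧸ Y` carries the (genuine) quotient norm. -/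
instance isClosed_spaceY : IsClosed (spaceY 𝕜 : Set (SpaceX 𝕜)) := by
  have h1 : Continuous fun p : SpaceX 𝕜 => seqLimL 𝕜 (inclX 𝕜 p).1 := by fun_prop
  have h2 : Continuous fun p : SpaceX 𝕜 => seqLimL 𝕜 (inclX 𝕜 p).2.1 := by fun_prop
  have h3 : Continuous fun p : SpaceX 𝕜 => seqLimL 𝕜 (inclX 𝕜 p).2.2 := by fun_prop
  exact (isClosed_eq h1 continuous_const).inter
    ((isClosed_eq h2 continuous_const).inter (isClosed_eq h3 continuous_const))

/-- The space of all `(a, b, c)` in three-dimensional `ℓ∞` with `a + b + c = 0`. -/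
def hexSpace : Submodule 𝕜 (𝕜 × 𝕜 × 𝕜) where
  carrier := {p | p.1 + p.2.1 + p.2.2 = 0}
  add_mem' := by
    intro p q hp hq
    simp only [Set.mem_ofPred_eq, Prod.fst_add, Prod.snd_add] at hp hq ⊢
    linear_combination hp + hq
  zero_mem' := by simp
  smul_mem' := by
    intro r p hp
    simp only [Set.mem_ofPred_eq, Prod.smul_fst, Prod.smul_snd, smul_eq_mul] at hp ⊢
    linear_combination r * hp

/-- The topological sum of three copies of the one-point compactification of `ℕ`. -/
abbrev threeNInfty : Type := OnePoint ℕ ⊕ OnePoint ℕ ⊕ OnePoint ℕ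

end Example

end

end NumericalIndex

open Filter Topology
open scoped BoundedContinuousFunction

namespace NumericalIndex

noncomputable section

/-! ### Coordinates and limits on `X` and on `H` -/

section Coordinates

variable (𝕜 : Type*) [RCLike 𝕜]

/-! The norm of `X` is a supremum of coordinates at isolated points of `K`, and the unit vectors
there have limit zero, so they belong to `X`. Any single coordinate may thus be changed freely
without leaving `X`. A vector of the unit ball is a convex combination of two vectors whose chosen
coordinate is unimodular, and at those the coordinate functional is, up to rotation, a supporting
functional. Hence `‖T‖ ≤ v(T)` and `n(X) = 1`. The same unit vectors, with the density of the
isolated points, give C-richness.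

On `H` the operator `R(a,b,c) = ((b-c)/2, (c-a)/2, (a-b)/2)` has norm one. For real scalars it is a
quarter turn of a regular hexagon, scaled so that vertices go to midpoints of edges. A functional on
`H` has coefficients `α` with `∑ ‖α i‖` at most its norm. If it attains its norm at `h` in the unit
ball, then `‖h i‖ = 1` wherever `α i ≠ 0`, and there the parallelogram law bounds the `i`-th
coordinate of `R h` by `√3/2` (`norm_sum_rotate_le`). So `n(H) ≤ √3/2`.

The dual inherits this defect. A functional splits into a part summed over coordinates and a part
seen only by limits. The two can be tested on disjoint sets of places, so their norms add and `Yᗮ`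
is an L-summand. Apply `R` to the limit part `ψ` of `φ`. If `F` in the bidual has norm one and `F φ
= 1 = ‖φ‖`, additivity makes `F` attain its norm at `ψ`, and the triple `F (lim i)`, which sums to
zero, takes the role of `h`. Hence `n(X*) ≤ √3/2` as well. -/

/-- The components of `X` in the three copies of `c`. -/
def compX (i : Fin 3) : SpaceX 𝕜 →L[𝕜] ConvSeq 𝕜 :=
  ![ContinuousLinearMap.fst 𝕜 _ _,
    (ContinuousLinearMap.fst 𝕜 _ _).comp (ContinuousLinearMap.snd 𝕜 _ _),
    (ContinuousLinearMap.snd 𝕜 _ _).comp (ContinuousLinearMap.snd 𝕜 _ _)] i ∘L inclX 𝕜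

/-- Evaluation of a convergent sequence at an index. -/
def evalSeq (n : ℕ) : ConvSeq 𝕜 →L[𝕜] 𝕜 :=
  (BoundedContinuousFunction.evalCLM 𝕜 n).comp (convSubmodule 𝕜).subtypeL

/-- The `n`-th coordinate in the `i`-th copy of `c`. -/
def coordX (i : Fin 3) (n : ℕ) : SpaceX 𝕜 →L[𝕜] 𝕜 := evalSeq 𝕜 n ∘L compX 𝕜 i

/-- The limit in the `i`-th copy of `c`. -/
def limX (i : Fin 3) : SpaceX 𝕜 →L[𝕜] 𝕜 := seqLimL 𝕜 ∘L compX 𝕜 i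

variable {𝕜}

theorem tendsto_coordX (i : Fin 3) (x : SpaceX 𝕜) :
    Tendsto (fun n => coordX 𝕜 i n x) atTop (𝓝 (limX 𝕜 i x)) :=
  tendsto_seqLim (compX 𝕜 i x)

theorem limX_eq_of_tendsto {i : Fin 3} {x : SpaceX 𝕜} {l : 𝕜}
    (h : Tendsto (fun n => coordX 𝕜 i n x) atTop (𝓝 l)) : limX 𝕜 i x = l :=
  tendsto_nhds_unique (tendsto_coordX i x) h

theorem sum_limX (x : SpaceX 𝕜) : ∑ i, limX 𝕜 i x = 0 := by
  rw [Fin.sum_univ_three]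
  exact x.2

theorem norm_convSeq_le_iff {x : ConvSeq 𝕜} {r : ℝ} (hr : 0 ≤ r) :
    ‖x‖ ≤ r ↔ ∀ n, ‖evalSeq 𝕜 n x‖ ≤ r :=
  BoundedContinuousFunction.norm_le (f := x.1) hr

theorem norm_spaceX_le_iff_compX {x : SpaceX 𝕜} {r : ℝ} :
    ‖x‖ ≤ r ↔ ∀ i, ‖compX 𝕜 i x‖ ≤ r := by
  rw [Fin.forall_fin_succ, Fin.forall_fin_two]
  change max _ (max _ _) ≤ r ↔ _
  rw [max_le_iff, max_le_iff]
  rfl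

theorem norm_spaceX_le_iff {x : SpaceX 𝕜} {r : ℝ} (hr : 0 ≤ r) :
    ‖x‖ ≤ r ↔ ∀ i n, ‖coordX 𝕜 i n x‖ ≤ r := by
  simp_rw [norm_spaceX_le_iff_compX, norm_convSeq_le_iff hr]
  rfl

theorem norm_coordX_le (i : Fin 3) (n : ℕ) (x : SpaceX 𝕜) : ‖coordX 𝕜 i n x‖ ≤ ‖x‖ :=
  (norm_spaceX_le_iff (norm_nonneg x)).1 le_rfl i n

theorem norm_limX_le (i : Fin 3) (x : SpaceX 𝕜) : ‖limX 𝕜 i x‖ ≤ ‖x‖ :=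
  le_of_tendsto (tendsto_coordX i x).norm (Eventually.of_forall fun n => norm_coordX_le i n x)

theorem spaceX_ext {x y : SpaceX 𝕜} (h : ∀ i n, coordX 𝕜 i n x = coordX 𝕜 i n y) : x = y := by
  rw [← sub_eq_zero, ← norm_le_zero_iff, norm_spaceX_le_iff le_rfl]
  intro i n
  simp [h i n]

/-- A convergent sequence as an element of `c`. -/
def mkSeq (f : ℕ → 𝕜) (l : 𝕜) (hf : Tendsto f atTop (𝓝 l)) : ConvSeq 𝕜 :=
  ⟨BoundedContinuousFunction.ofNormedAddCommGroupDiscrete f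
    (Metric.isBounded_range_of_tendsto f hf).exists_norm_le.choose
    fun n => (Metric.isBounded_range_of_tendsto f hf).exists_norm_le.choose_spec _ ⟨n, rfl⟩, l, hf⟩

theorem seqLim_mkSeq (f : ℕ → 𝕜) (l : 𝕜) (hf : Tendsto f atTop (𝓝 l)) :
    seqLim (mkSeq f l hf) = l :=
  tendsto_nhds_unique (tendsto_seqLim _) hf

/-- The element of `X` with given coordinates. -/
def mkX (f : Fin 3 → ℕ → 𝕜) (l : Fin 3 → 𝕜) (hf : ∀ i, Tendsto (f i) atTop (𝓝 (l i)))
    (hl : ∑ i, l i = 0) : SpaceX 𝕜 :=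
  ⟨(mkSeq (f 0) (l 0) (hf 0), mkSeq (f 1) (l 1) (hf 1), mkSeq (f 2) (l 2) (hf 2)), by
    change seqLim _ + seqLim _ + seqLim _ = 0
    simpa only [seqLim_mkSeq, Fin.sum_univ_three] using hl⟩

@[simp]
theorem coordX_mkX (f : Fin 3 → ℕ → 𝕜) (l : Fin 3 → 𝕜) (hf : ∀ i, Tendsto (f i) atTop (𝓝 (l i)))
    (hl : ∑ i, l i = 0) (i : Fin 3) (n : ℕ) : coordX 𝕜 i n (mkX f l hf hl) = f i n := by
  fin_cases i <;> rfl

@[simp]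
theorem limX_mkX (f : Fin 3 → ℕ → 𝕜) (l : Fin 3 → 𝕜) (hf : ∀ i, Tendsto (f i) atTop (𝓝 (l i)))
    (hl : ∑ i, l i = 0) (i : Fin 3) : limX 𝕜 i (mkX f l hf hl) = l i :=
  limX_eq_of_tendsto (by simpa using hf i)

theorem mem_spaceY {x : SpaceX 𝕜} : x ∈ spaceY 𝕜 ↔ ∀ i, limX 𝕜 i x = 0 := by
  rw [Fin.forall_fin_succ, Fin.forall_fin_two]
  rfl

variable (𝕜)

/-- The coordinates of the hexagonal space. -/
def coordH (i : Fin 3) : hexSpace 𝕜 →L[𝕜] 𝕜 :=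
  ![ContinuousLinearMap.fst 𝕜 _ _,
    (ContinuousLinearMap.fst 𝕜 _ _).comp (ContinuousLinearMap.snd 𝕜 _ _),
    (ContinuousLinearMap.snd 𝕜 _ _).comp (ContinuousLinearMap.snd 𝕜 _ _)] i ∘L (hexSpace 𝕜).subtypeL

variable {𝕜}

theorem sum_coordH (x : hexSpace 𝕜) : ∑ i, coordH 𝕜 i x = 0 := by
  rw [Fin.sum_univ_three]
  exact x.2

theorem norm_hexSpace_le_iff {x : hexSpace 𝕜} {r : ℝ} :
    ‖x‖ ≤ r ↔ ∀ i, ‖coordH 𝕜 i x‖ ≤ r := by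
  rw [Fin.forall_fin_succ, Fin.forall_fin_two]
  change max _ (max _ _) ≤ r ↔ _
  rw [max_le_iff, max_le_iff]
  rfl

theorem norm_coordH_le (i : Fin 3) (x : hexSpace 𝕜) : ‖coordH 𝕜 i x‖ ≤ ‖x‖ :=
  norm_hexSpace_le_iff.1 le_rfl i

theorem hexSpace_ext {x y : hexSpace 𝕜} (h : ∀ i, coordH 𝕜 i x = coordH 𝕜 i y) : x = y :=
  Subtype.ext (Prod.ext (h 0) (Prod.ext (h 1) (h 2)))

/-- The element of the hexagonal space with given coordinates. -/
def mkH (h : Fin 3 → 𝕜) (hh : ∑ i, h i = 0) : hexSpace 𝕜 :=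
  ⟨(h 0, h 1, h 2), by rwa [Fin.sum_univ_three] at hh⟩

@[simp]
theorem coordH_mkH (h : Fin 3 → 𝕜) (hh : ∑ i, h i = 0) (i : Fin 3) :
    coordH 𝕜 i (mkH h hh) = h i := by
  fin_cases i <;> rfl

variable (𝕜)

/-- The triple of limits of an element of `X`. -/
def limHex : SpaceX 𝕜 →L[𝕜] hexSpace 𝕜 :=
  LinearMap.mkContinuous
    { toFun := fun x => mkH (fun i => limX 𝕜 i x) (sum_limX x)
      map_add' := fun x y => hexSpace_ext (by simp)
      map_smul' := fun r x => hexSpace_ext (by simp) } 1 fun x => by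
    rw [one_mul, norm_hexSpace_le_iff]
    simpa using fun i => norm_limX_le i x

/-- The triples of constant sequences in `X`. -/
def constX : hexSpace 𝕜 →L[𝕜] SpaceX 𝕜 :=
  LinearMap.mkContinuous
    { toFun := fun h => mkX (fun i _ => coordH 𝕜 i h) (fun i => coordH 𝕜 i h)
        (fun _ => tendsto_const_nhds) (sum_coordH h)
      map_add' := fun x y => spaceX_ext (by simp)
      map_smul' := fun r x => spaceX_ext (by simp) } 1 fun x => by
    rw [one_mul, norm_spaceX_le_iff (norm_nonneg x)]
    simpa using fun i => norm_coordH_le i x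

variable {𝕜}

@[simp]
theorem coordH_limHex (i : Fin 3) (x : SpaceX 𝕜) : coordH 𝕜 i (limHex 𝕜 x) = limX 𝕜 i x :=
  coordH_mkH _ _ i

@[simp]
theorem coordX_constX (i : Fin 3) (n : ℕ) (h : hexSpace 𝕜) :
    coordX 𝕜 i n (constX 𝕜 h) = coordH 𝕜 i h :=
  coordX_mkX _ _ _ _ i n

@[simp]
theorem limX_constX (i : Fin 3) (h : hexSpace 𝕜) : limX 𝕜 i (constX 𝕜 h) = coordH 𝕜 i h :=
  limX_mkX _ _ _ _ i

@[simp]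
theorem limHex_constX (h : hexSpace 𝕜) : limHex 𝕜 (constX 𝕜 h) = h :=
  hexSpace_ext (by simp)

theorem norm_limHex_le (x : SpaceX 𝕜) : ‖limHex 𝕜 x‖ ≤ ‖x‖ :=
  norm_hexSpace_le_iff.2 (by simpa using fun i => norm_limX_le i x)

theorem norm_constX_le (h : hexSpace 𝕜) : ‖constX 𝕜 h‖ ≤ ‖h‖ :=
  (norm_spaceX_le_iff (norm_nonneg h)).2 (by simpa using fun i => norm_coordH_le i h)

theorem mem_spaceY_iff_limHex {x : SpaceX 𝕜} : x ∈ spaceY 𝕜 ↔ limHex 𝕜 x = 0 := by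
  rw [mem_spaceY]
  refine ⟨fun h => hexSpace_ext (by simpa using h), fun h i => ?_⟩
  rw [← coordH_limHex, h, map_zero]

/-- Subtracting from `x` the constants equal to its limits leaves an element of `Y`. -/
theorem apply_eq_of_mem_annihilator {f : StrongDual 𝕜 (SpaceX 𝕜)}
    (hf : f ∈ annihilator (spaceY 𝕜)) (x : SpaceX 𝕜) : f x = f (constX 𝕜 (limHex 𝕜 x)) := by
  rw [← sub_eq_zero, ← map_sub]
  refine hf _ (mem_spaceY_iff_limHex.2 ?_)
  simp

end Coordinates

/-! ### Numerical radius and numerical index -/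

section Radius

variable {𝕜 : Type*} [RCLike 𝕜] {E : Type*} [NormedAddCommGroup E] [NormedSpace 𝕜 E]

theorem norm_le_of_mem_numericalRange {T : E →L[𝕜] E} {w : 𝕜} (hw : w ∈ numericalRange 𝕜 T) :
    ‖w‖ ≤ ‖T‖ := by
  obtain ⟨x, f, hx, hf, -, rfl⟩ := hw
  calc ‖f (T x)‖ ≤ ‖f‖ * (‖T‖ * ‖x‖) := f.le_opNorm_of_le (T.le_opNorm x)
    _ = ‖T‖ := by rw [hx, hf]; ring

theorem numericalRadius_nonneg (T : E →L[𝕜] E) : 0 ≤ numericalRadius 𝕜 T := by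
  refine Real.sSup_nonneg ?_
  rintro _ ⟨w, -, rfl⟩
  exact norm_nonneg w

theorem numericalRadius_le {T : E →L[𝕜] E} {r : ℝ} (hr : 0 ≤ r)
    (h : ∀ w ∈ numericalRange 𝕜 T, ‖w‖ ≤ r) : numericalRadius 𝕜 T ≤ r := by
  refine Real.sSup_le ?_ hr
  rintro _ ⟨w, hw, rfl⟩
  exact h w hw

theorem norm_le_numericalRadius {T : E →L[𝕜] E} {w : 𝕜} (hw : w ∈ numericalRange 𝕜 T) :
    ‖w‖ ≤ numericalRadius 𝕜 T := by
  refine le_csSup ⟨‖T‖, ?_⟩ ⟨w, hw, rfl⟩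
  rintro _ ⟨w, hw, rfl⟩
  exact norm_le_of_mem_numericalRange hw

theorem numericalIndex_le {T : E →L[𝕜] E} (hT : ‖T‖ = 1) :
    numericalIndex 𝕜 E ≤ numericalRadius 𝕜 T := by
  refine csInf_le ⟨0, ?_⟩ ⟨T, hT, rfl⟩
  rintro _ ⟨S, -, rfl⟩
  exact numericalRadius_nonneg S

theorem numericalIndex_eq_one [Nontrivial E]
    (h : ∀ T : E →L[𝕜] E, ‖T‖ ≤ numericalRadius 𝕜 T) : numericalIndex 𝕜 E = 1 := by
  have key (T : E →L[𝕜] E) : numericalRadius 𝕜 T = ‖T‖ :=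
    le_antisymm (numericalRadius_le (norm_nonneg T) fun _ => norm_le_of_mem_numericalRange) (h T)
  have : numericalRadius 𝕜 '' {T : E →L[𝕜] E | ‖T‖ = 1} = {1} := by
    ext r
    constructor
    · rintro ⟨T, hT, rfl⟩
      exact (key T).trans hT
    -- The identity keeps the set of radii nonempty; its norm is one because `E` is nontrivial.
    · rintro rfl
      exact ⟨ContinuousLinearMap.id 𝕜 E, ContinuousLinearMap.norm_id,
        (key _).trans ContinuousLinearMap.norm_id⟩
  rw [numericalIndex, this, csInf_singleton]

end Radius

/-! ### Numerical index and completeness of `X` -/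

section IndexX

variable {𝕜 : Type*} [RCLike 𝕜]

/-- The unit vector of `X` at the `n`-th place of the `i`-th copy of `c`. -/
def unitX (𝕜 : Type*) [RCLike 𝕜] (i : Fin 3) (n : ℕ) : SpaceX 𝕜 :=
  mkX (fun j m => if j = i ∧ m = n then 1 else 0) 0
    (fun j => tendsto_const_nhds.congr' <| (eventually_gt_atTop n).mono fun m hm => by
      simp [hm.ne']) (by simp)

@[simp]
theorem coordX_unitX (i j : Fin 3) (n m : ℕ) :
    coordX 𝕜 j m (unitX 𝕜 i n) = if j = i ∧ m = n then 1 else 0 :=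
  coordX_mkX _ _ _ _ j m

instance : Nontrivial (SpaceX 𝕜) :=
  ⟨unitX 𝕜 0 0, 0, fun h => by simpa using congrArg (coordX 𝕜 0 0) h⟩

theorem exists_unimodular_convex (a : 𝕜) (ha : ‖a‖ ≤ 1) :
    ∃ (u : 𝕜) (r : ℝ), ‖u‖ = 1 ∧ 0 ≤ r ∧ r ≤ 1 ∧ a = r * u := by
  by_cases h : a = 0
  · exact ⟨1, 0, by simp [h]⟩
  · have h' : (‖a‖ : 𝕜) ≠ 0 := by simpa using h
    refine ⟨a / ‖a‖, ‖a‖, ?_, norm_nonneg a, ha, ?_⟩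
    · rw [norm_div, RCLike.norm_coe_norm, div_self (norm_ne_zero_iff.2 h)]
    · field_simp

/-- Replacing one coordinate of an element of the unit ball of `X` by a unimodular scalar. -/
theorem norm_add_unitX {x : SpaceX 𝕜} (hx : ‖x‖ ≤ 1) {i : Fin 3} {n : ℕ} {b : 𝕜}
    (hb : ‖coordX 𝕜 i n x + b‖ = 1) : ‖x + b • unitX 𝕜 i n‖ = 1 := by
  refine le_antisymm ((norm_spaceX_le_iff zero_le_one).2 fun j m => ?_) ?_
  · by_cases h : j = i ∧ m = n
    · obtain ⟨rfl, rfl⟩ := h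
      simpa using hb.le
    · simpa [h] using (norm_coordX_le j m x).trans hx
  · simpa [hb] using norm_coordX_le i n (x + b • unitX 𝕜 i n)

theorem norm_coordX_eq (i : Fin 3) (n : ℕ) : ‖coordX 𝕜 i n‖ = 1 := by
  refine le_antisymm (ContinuousLinearMap.opNorm_le_bound _ zero_le_one fun x => by
    simpa using norm_coordX_le i n x) ?_
  have h := (coordX 𝕜 i n).le_opNorm (0 + (1 : 𝕜) • unitX 𝕜 i n)
  rw [norm_add_unitX (by simp) (by simp)] at h
  simpa using h

theorem norm_coordX_apply_le_numericalRadius (T : SpaceX 𝕜 →L[𝕜] SpaceX 𝕜) {x : SpaceX 𝕜}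
    (hx : ‖x‖ = 1) {i : Fin 3} {n : ℕ} (hi : ‖coordX 𝕜 i n x‖ = 1) :
    ‖coordX 𝕜 i n (T x)‖ ≤ numericalRadius 𝕜 T := by
  set u := coordX 𝕜 i n x
  have hu : ‖(starRingEnd 𝕜) u‖ = 1 := by rw [RCLike.norm_conj, hi]
  have := norm_le_numericalRadius (T := T) (w := starRingEnd 𝕜 u * coordX 𝕜 i n (T x))
    -- The conjugate of the unimodular value `u` rotates the coordinate functional so that it equals
    -- 1 at `x`.
    ⟨x, starRingEnd 𝕜 u • coordX 𝕜 i n, hx, by rw [norm_smul, norm_coordX_eq, hu, one_mul], by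
      change starRingEnd 𝕜 u * u = 1
      rw [RCLike.conj_mul, hi]; simp, rfl⟩
  rwa [norm_mul, hu, one_mul] at this

/-- Each coordinate of `T x` is a convex combination of coordinates of `T` at vectors where the
numerical radius controls them. -/
theorem norm_le_numericalRadius_spaceX (T : SpaceX 𝕜 →L[𝕜] SpaceX 𝕜) :
    ‖T‖ ≤ numericalRadius 𝕜 T := by
  have hv := numericalRadius_nonneg T
  refine ContinuousLinearMap.opNorm_le_of_unit_norm hv fun x hx => ?_
  rw [norm_spaceX_le_iff hv]
  intro i n
  obtain ⟨u, r, hu, hr0, hr1, ha⟩ := exists_unimodular_convex (coordX 𝕜 i n x)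
    ((norm_coordX_le i n x).trans hx.le)
  -- The chosen coordinate is `r * u`, a point between `u` and `-u` with weights `(1 ± r) / 2`; all
  -- other coordinates stay unchanged.
  have hdecomp : x = (((1 + r) / 2 : ℝ) : 𝕜) • (x + (u - coordX 𝕜 i n x) • unitX 𝕜 i n) +
      (((1 - r) / 2 : ℝ) : 𝕜) • (x + (-u - coordX 𝕜 i n x) • unitX 𝕜 i n) := by
    rw [ha]
    push_cast
    module
  have h1 := norm_coordX_apply_le_numericalRadius T
    (norm_add_unitX hx.le (b := u - coordX 𝕜 i n x) (i := i) (n := n) (by simpa using hu))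
    (i := i) (n := n) (by simpa using hu)
  have h2 := norm_coordX_apply_le_numericalRadius T
    (norm_add_unitX hx.le (b := -u - coordX 𝕜 i n x) (i := i) (n := n) (by simpa using hu))
    (i := i) (n := n) (by simpa using hu)
  conv_lhs => rw [hdecomp]
  rw [map_add, map_add, map_smul, map_smul, map_smul, map_smul]
  refine (norm_add_le _ _).trans ?_
  rw [norm_smul, norm_smul, RCLike.norm_ofReal, RCLike.norm_ofReal,
    abs_of_nonneg (by linarith), abs_of_nonneg (by linarith)]
  nlinarith

theorem numericalIndex_spaceX : numericalIndex 𝕜 (SpaceX 𝕜) = 1 :=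
  numericalIndex_eq_one norm_le_numericalRadius_spaceX

theorem isClosed_subspaceX :
    IsClosed (subspaceX 𝕜 : Set (ConvSeq 𝕜 × ConvSeq 𝕜 × ConvSeq 𝕜)) := by
  have h : Continuous fun p : ConvSeq 𝕜 × ConvSeq 𝕜 × ConvSeq 𝕜 =>
    seqLimL 𝕜 p.1 + seqLimL 𝕜 p.2.1 + seqLimL 𝕜 p.2.2 := by fun_prop
  exact isClosed_eq h continuous_const

theorem isClosed_convSubmodule : IsClosed (convSubmodule 𝕜 : Set (ℕ →ᵇ 𝕜)) := by
  refine isClosed_of_closure_subset fun x hx => ?_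
  refine cauchySeq_tendsto_of_complete (Metric.cauchySeq_iff'.2 fun ε hε => ?_)
  obtain ⟨y, ⟨l, hl⟩, hy⟩ := Metric.mem_closure_iff.1 hx (ε / 3) (by positivity)
  obtain ⟨N, hN⟩ := Metric.cauchySeq_iff'.1 hl.cauchySeq (ε / 3) (by positivity)
  refine ⟨N, fun n hn => ?_⟩
  have h1 := (BoundedContinuousFunction.dist_coe_le_dist (f := x) (g := y) n).trans_lt hy
  have h2 := (BoundedContinuousFunction.dist_coe_le_dist (f := x) (g := y) N).trans_lt hy
  rw [dist_comm] at h2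
  calc dist (x n) (x N) ≤ dist (x n) (y n) + dist (y n) (y N) + dist (y N) (x N) :=
        dist_triangle4 _ _ _ _
    _ < ε := by linarith [hN n hn]

instance : CompleteSpace (ConvSeq 𝕜) :=
  isClosed_convSubmodule.completeSpace_coe

theorem completeSpace_spaceX : CompleteSpace (SpaceX 𝕜) :=
  isClosed_subspaceX.completeSpace_coe

end IndexX

/-! ### The space `H` and its numerical index -/

section Hexagon

variable {𝕜 : Type*} [RCLike 𝕜]

/-- Since `‖b + c‖ = ‖a‖ = 1`, the parallelogram law gives `‖b - c‖ ^ 2 ≤ 4 - 1 = 3`. -/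
theorem norm_half_sub_le {a b c : 𝕜} (h : a + b + c = 0) (ha : ‖a‖ = 1) (hb : ‖b‖ ≤ 1)
    (hc : ‖c‖ ≤ 1) : ‖(b - c) / 2‖ ≤ √3 / 2 := by
  have h1 := parallelogram_law_with_norm 𝕜 b c
  have h2 : ‖b + c‖ = 1 := by
    rw [← ha, ← norm_neg a]; congr 1; linear_combination h
  rw [h2] at h1
  rw [norm_div, RCLike.norm_ofNat]
  gcongr
  apply Real.le_sqrt_of_sq_le
  nlinarith [norm_nonneg b, norm_nonneg c]

/-- If `∑ α i * h i` attains the norm of `α`, then the rotated pairing is strictly smaller. -/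
theorem norm_sum_rotate_le {α h : Fin 3 → 𝕜} (hs : ∑ i, h i = 0) (hh : ∀ i, ‖h i‖ ≤ 1)
    (hα : ∑ i, ‖α i‖ ≤ ‖∑ i, α i * h i‖) :
    ‖∑ i, α i * ((h (i + 1) - h (i + 2)) / 2)‖ ≤ √3 / 2 * ∑ i, ‖α i‖ := by
  have hle (i) : ‖α i * h i‖ ≤ ‖α i‖ := by
    rw [norm_mul]; exact mul_le_of_le_one_right (norm_nonneg _) (hh i)
  -- Equality of the sums forces equality in every term, hence `‖h i‖ = 1` wherever `α i ≠ 0`.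
  have heq : ∀ i ∈ Finset.univ, ‖α i * h i‖ = ‖α i‖ :=
    (Finset.sum_eq_sum_iff_of_le fun i _ => hle i).1
      (le_antisymm (Finset.sum_le_sum fun i _ => hle i) (hα.trans (norm_sum_le _ _)))
  rw [Finset.mul_sum]
  refine (norm_sum_le _ _).trans (Finset.sum_le_sum fun i _ => ?_)
  rw [norm_mul, mul_comm]
  by_cases h0 : α i = 0
  · simp [h0]
  · gcongr
    have hi : ‖h i‖ = 1 := by
      have := heq i (Finset.mem_univ i)
      rw [norm_mul] at this
      exact mul_left_cancel₀ (norm_ne_zero_iff.2 h0) (this.trans (mul_one _).symm)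
    refine norm_half_sub_le ?_ hi (hh _) (hh _)
    rw [Fin.sum_univ_three] at hs
    fin_cases i <;> simp only [Fin.reduceFinMk, Fin.reduceAdd, Fin.zero_eta, Fin.mk_one, zero_add] <;>
      linear_combination hs

theorem exists_rotation (z : 𝕜) : ∃ w : 𝕜, ‖w‖ = 1 ∧ w * z = (‖z‖ : 𝕜) := by
  obtain ⟨w, hw, h⟩ := RCLike.exists_norm_eq_mul_self z
  exact ⟨w, hw, h.symm⟩

/-- Functionals on the hexagonal space are given by scalar triples without increasing the norm. -/
theorem exists_coeff_hexSpace (f : StrongDual 𝕜 (hexSpace 𝕜)) :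
    ∃ α : Fin 3 → 𝕜, (∀ h, f h = ∑ i, α i * coordH 𝕜 i h) ∧ ∑ i, ‖α i‖ ≤ ‖f‖ := by
  -- The coefficients come from a Hahn–Banach extension to three-dimensional `ℓ∞`, whose dual norm
  -- is the `ℓ¹` norm.
  obtain ⟨g, hg, hn⟩ := exists_extension_norm_eq (hexSpace 𝕜) f
  have hexp (a b c : 𝕜) : g (a, b, c) = g (1, 0, 0) * a + g (0, 1, 0) * b + g (0, 0, 1) * c := by
    have : ((a, b, c) : 𝕜 × 𝕜 × 𝕜) =
        a • ((1, 0, 0) : 𝕜 × 𝕜 × 𝕜) + b • ((0, 1, 0) : 𝕜 × 𝕜 × 𝕜) + c • ((0, 0, 1) : 𝕜 × 𝕜 × 𝕜) := by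
      simp
    conv_lhs => rw [this, map_add, map_add, map_smul, map_smul, map_smul]
    simp only [smul_eq_mul]
    ring
  refine ⟨![g (1, 0, 0), g (0, 1, 0), g (0, 0, 1)], fun h => ?_, ?_⟩
  · rw [← hg h, Fin.sum_univ_three]
    exact hexp _ _ _
  · choose s hs1 hs using exists_rotation (𝕜 := 𝕜)
    simp only [mul_comm (s _)] at hs
    rw [← hn, Fin.sum_univ_three]
    have h1 := g.le_opNorm (s (g (1, 0, 0)), s (g (0, 1, 0)), s (g (0, 0, 1)))
    rw [hexp, hs, hs, hs] at h1
    have h2 : ‖((s (g (1, 0, 0)), s (g (0, 1, 0)), s (g (0, 0, 1))) : 𝕜 × 𝕜 × 𝕜)‖ ≤ 1 :=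
      max_le (hs1 _).le (max_le (hs1 _).le (hs1 _).le)
    have h3 := h1.trans (mul_le_of_le_one_right (norm_nonneg _) h2)
    rw [← RCLike.ofReal_add, ← RCLike.ofReal_add, RCLike.norm_ofReal] at h3
    exact (le_abs_self _).trans h3

variable (𝕜)

/-- The linear map `(a, b, c) ↦ ((b - c) / 2, (c - a) / 2, (a - b) / 2)`. -/
def rotHLin : hexSpace 𝕜 →ₗ[𝕜] hexSpace 𝕜 where
  toFun h := mkH (fun i => (coordH 𝕜 (i + 1) h - coordH 𝕜 (i + 2) h) / 2) (by
    simp only [Fin.sum_univ_three, Fin.reduceAdd, zero_add]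
    ring)
  map_add' x y := hexSpace_ext fun i => by
    simp only [coordH_mkH, map_add]
    ring
  map_smul' r x := hexSpace_ext fun i => by
    simp only [coordH_mkH, map_smul, smul_eq_mul, RingHom.id_apply]
    ring

theorem norm_rotHLin_le (h : hexSpace 𝕜) : ‖rotHLin 𝕜 h‖ ≤ 1 * ‖h‖ := by
  rw [one_mul, norm_hexSpace_le_iff]
  intro i
  have h1 := norm_coordH_le (i + 1) h
  have h2 := norm_coordH_le (i + 2) h
  have h3 := norm_sub_le (coordH 𝕜 (i + 1) h) (coordH 𝕜 (i + 2) h)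
  have h4 : coordH 𝕜 i (rotHLin 𝕜 h) = (coordH 𝕜 (i + 1) h - coordH 𝕜 (i + 2) h) / 2 :=
    coordH_mkH _ _ i
  rw [h4, norm_div, RCLike.norm_ofNat]
  linarith

/-- The operator `(a, b, c) ↦ ((b - c) / 2, (c - a) / 2, (a - b) / 2)`. -/
def rotH : hexSpace 𝕜 →L[𝕜] hexSpace 𝕜 :=
  (rotHLin 𝕜).mkContinuous 1 (norm_rotHLin_le 𝕜)

/-- The vector `(0, 1, -1)`. -/
def edgeH : hexSpace 𝕜 := mkH ![0, 1, -1] (by simp [Fin.sum_univ_three])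

variable {𝕜}

@[simp]
theorem coordH_rotH (i : Fin 3) (h : hexSpace 𝕜) :
    coordH 𝕜 i (rotH 𝕜 h) = (coordH 𝕜 (i + 1) h - coordH 𝕜 (i + 2) h) / 2 :=
  coordH_mkH _ _ i

theorem norm_rotH_le (h : hexSpace 𝕜) : ‖rotH 𝕜 h‖ ≤ ‖h‖ := by
  simpa using (rotH 𝕜).le_of_opNorm_le (LinearMap.mkContinuous_norm_le _ zero_le_one _) h

theorem norm_edgeH_le : ‖edgeH 𝕜‖ ≤ 1 :=
  norm_hexSpace_le_iff.2 fun i => by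
    rw [edgeH, coordH_mkH]
    fin_cases i <;> simp

theorem coordH_zero_rotH_edgeH : coordH 𝕜 0 (rotH 𝕜 (edgeH 𝕜)) = 1 := by
  rw [coordH_rotH, edgeH, coordH_mkH, coordH_mkH]
  change ((1 : 𝕜) - -1) / 2 = 1
  norm_num

theorem norm_rotH : ‖rotH 𝕜‖ = 1 := by
  refine le_antisymm (LinearMap.mkContinuous_norm_le _ zero_le_one _) ?_
  have h := (norm_coordH_le 0 (rotH 𝕜 (edgeH 𝕜))).trans
    ((rotH 𝕜).le_opNorm_of_le norm_edgeH_le)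
  simpa [coordH_zero_rotH_edgeH, -coordH_rotH] using h

theorem sqrt_three_div_two_lt_one : √3 / 2 < 1 := by
  rw [div_lt_one two_pos, Real.sqrt_lt' two_pos]
  norm_num

theorem numericalIndex_hexSpace_lt_one : numericalIndex 𝕜 (hexSpace 𝕜) < 1 := by
  refine ((numericalIndex_le (norm_rotH (𝕜 := 𝕜))).trans
    (numericalRadius_le (by positivity) ?_)).trans_lt sqrt_three_div_two_lt_one
  rintro _ ⟨x, f, hx, hf, hfx, rfl⟩
  obtain ⟨α, hα, hn⟩ := exists_coeff_hexSpace f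
  rw [hf] at hn
  have h := norm_sum_rotate_le (α := α) (sum_coordH x)
    (fun i => (norm_coordH_le i x).trans hx.le) (by rw [← hα, hfx]; simpa using hn)
  rw [hα]
  simp only [coordH_rotH]
  exact h.trans (mul_le_of_le_one_right (by positivity) hn)

theorem finrank_hexSpace : Module.finrank 𝕜 (hexSpace 𝕜) = 2 := by
  let e : hexSpace 𝕜 ≃ₗ[𝕜] 𝕜 × 𝕜 :=
    { toFun := fun h => (coordH 𝕜 0 h, coordH 𝕜 1 h)
      map_add' := fun x y => by simp
      map_smul' := fun r x => by simp
      invFun := fun p => mkH ![p.1, p.2, -(p.1 + p.2)] (by simp [Fin.sum_univ_three])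
      left_inv := fun x => by
        have := sum_coordH x
        rw [Fin.sum_univ_three] at this
        refine hexSpace_ext fun i => ?_
        rw [coordH_mkH]
        fin_cases i
        · rfl
        · rfl
        · change -(coordH 𝕜 0 x + coordH 𝕜 1 x) = coordH 𝕜 2 x
          linear_combination -this
      right_inv := fun p => by simp }
  rw [e.finrank_eq, Module.finrank_prod, Module.finrank_self]

end Hexagon

/-! ### The L-projection of `X*` onto the annihilator of `Y` -/

section Projection

variable {𝕜 : Type*} [RCLike 𝕜]

variable (𝕜) in
/-- The projection of `X` onto the `n`-th coordinates of the three copies of `c`. -/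
def blockX (n : ℕ) : SpaceX 𝕜 →L[𝕜] SpaceX 𝕜 :=
  ∑ i, (coordX 𝕜 i n).smulRight (unitX 𝕜 i n)

@[simp]
theorem coordX_blockX (n m : ℕ) (i : Fin 3) (x : SpaceX 𝕜) :
    coordX 𝕜 i m (blockX 𝕜 n x) = if m = n then coordX 𝕜 i m x else 0 := by
  rw [blockX, sum_apply, map_sum]
  by_cases h : m = n
  · subst h
    simp
  · simp [h]

variable (𝕜) in
/-- The projection of `X` onto the first `N` coordinates of the three copies of `c`. -/
def headX (N : ℕ) : SpaceX 𝕜 →L[𝕜] SpaceX 𝕜 := ∑ n ∈ Finset.range N, blockX 𝕜 n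

@[simp]
theorem coordX_headX (N m : ℕ) (i : Fin 3) (x : SpaceX 𝕜) :
    coordX 𝕜 i m (headX 𝕜 N x) = if m < N then coordX 𝕜 i m x else 0 := by
  rw [headX, sum_apply, map_sum]
  simp

/-- The blocks have disjoint supports, so multiplying each by a unimodular scalar that makes its
value under `φ` nonnegative does not increase the norm. -/
theorem sum_norm_blockX_le (φ : StrongDual 𝕜 (SpaceX 𝕜)) (x : SpaceX 𝕜) (N : ℕ) :
    ∑ n ∈ Finset.range N, ‖φ (blockX 𝕜 n x)‖ ≤ ‖φ‖ * ‖x‖ := by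
  choose w hw1 hw using fun n => exists_rotation (φ (blockX 𝕜 n x))
  have hz : ‖∑ n ∈ Finset.range N, w n • blockX 𝕜 n x‖ ≤ ‖x‖ := by
    refine (norm_spaceX_le_iff (norm_nonneg x)).2 fun i m => ?_
    rw [map_sum]
    simp only [map_smul, coordX_blockX, smul_eq_mul, mul_ite, mul_zero, Finset.sum_ite_eq]
    split_ifs
    · simpa [hw1] using norm_coordX_le i m x
    · simp
  have h := φ.le_opNorm_of_le hz
  rw [map_sum] at h
  simp only [map_smul, smul_eq_mul, hw] at h
  rw [← RCLike.ofReal_sum, RCLike.norm_ofReal] at h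
  exact (le_abs_self _).trans h

theorem summable_blockX (φ : StrongDual 𝕜 (SpaceX 𝕜)) (x : SpaceX 𝕜) :
    Summable fun n => φ (blockX 𝕜 n x) :=
  (summable_of_sum_range_le (fun _ => norm_nonneg _) (sum_norm_blockX_le φ x)).of_norm

theorem tendsto_headX (φ : StrongDual 𝕜 (SpaceX 𝕜)) (x : SpaceX 𝕜) :
    Tendsto (fun N => φ (headX 𝕜 N x)) atTop (𝓝 (∑' n, φ (blockX 𝕜 n x))) := by
  simpa [headX] using (summable_blockX φ x).hasSum.tendsto_sum_nat

theorem norm_tsum_blockX_le (φ : StrongDual 𝕜 (SpaceX 𝕜)) (x : SpaceX 𝕜) :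
    ‖∑' n, φ (blockX 𝕜 n x)‖ ≤ 1 * ‖φ‖ * ‖x‖ := by
  rw [one_mul]
  refine le_of_tendsto (tendsto_headX φ x).norm (Eventually.of_forall fun N => ?_)
  refine le_trans ?_ (sum_norm_blockX_le φ x N)
  simpa [headX] using norm_sum_le (Finset.range N) fun n => φ (blockX 𝕜 n x)

variable (𝕜) in
/-- The projection `φ ↦ (x ↦ ∑ φ(xₙ))` of `X*` onto the summable part of functionals. -/
def sumProj : StrongDual 𝕜 (SpaceX 𝕜) →L[𝕜] StrongDual 𝕜 (SpaceX 𝕜) :=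
  LinearMap.mkContinuous₂
    (LinearMap.mk₂ 𝕜 (fun (φ : StrongDual 𝕜 (SpaceX 𝕜)) (x : SpaceX 𝕜) => ∑' n, φ (blockX 𝕜 n x))
      (fun φ ψ x => (summable_blockX φ x).tsum_add (summable_blockX ψ x))
      (fun r φ x => tsum_mul_left)
      (fun φ x y => by
        simp only [map_add]
        exact (summable_blockX φ x).tsum_add (summable_blockX φ y))
      (fun r φ x => by
        simp only [map_smul, smul_eq_mul]
        exact tsum_mul_left)) 1 norm_tsum_blockX_le

theorem tendsto_sumProj (φ : StrongDual 𝕜 (SpaceX 𝕜)) (x : SpaceX 𝕜) :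
    Tendsto (fun N => φ (headX 𝕜 N x)) atTop (𝓝 (sumProj 𝕜 φ x)) :=
  tendsto_headX φ x

variable (𝕜) in
/-- The complementary projection of `X*` onto the annihilator of `Y`. -/
def limProj : StrongDual 𝕜 (SpaceX 𝕜) →L[𝕜] StrongDual 𝕜 (SpaceX 𝕜) := 1 - sumProj 𝕜

theorem tendsto_limProj (φ : StrongDual 𝕜 (SpaceX 𝕜)) (x : SpaceX 𝕜) :
    Tendsto (fun N => φ (x - headX 𝕜 N x)) atTop (𝓝 (limProj 𝕜 φ x)) := by
  simp_rw [map_sub]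
  exact (tendsto_sumProj φ x).const_sub _

theorem headX_mem_spaceY (N : ℕ) (x : SpaceX 𝕜) : headX 𝕜 N x ∈ spaceY 𝕜 :=
  mem_spaceY.2 fun _ => limX_eq_of_tendsto <| tendsto_const_nhds.congr' <|
    (eventually_ge_atTop N).mono fun m hm => by simp [not_lt.2 hm]

theorem tendsto_headX_of_mem_spaceY {y : SpaceX 𝕜} (hy : y ∈ spaceY 𝕜) :
    Tendsto (fun N => y - headX 𝕜 N y) atTop (𝓝 0) := by
  rw [tendsto_zero_iff_norm_tendsto_zero, Metric.tendsto_atTop]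
  intro ε hε
  have h : ∀ i, ∀ᶠ n in atTop, ‖coordX 𝕜 i n y‖ < ε / 2 := fun i => by
    have := (tendsto_coordX i y).norm
    rw [mem_spaceY.1 hy i, norm_zero] at this
    exact this.eventually_lt_const (by positivity)
  obtain ⟨N, hN⟩ := eventually_atTop.1 (eventually_all.2 h)
  refine ⟨N, fun n hn => ?_⟩
  rw [Real.dist_0_eq_abs, abs_norm]
  refine lt_of_le_of_lt ((norm_spaceX_le_iff (r := ε / 2) (by positivity)).2 fun i m => ?_)
    (half_lt_self hε)
  rw [map_sub, coordX_headX]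
  split_ifs with hm
  · simp only [sub_self, norm_zero]
    positivity
  · rw [sub_zero]
    exact (hN m (hn.trans (not_lt.1 hm)) i).le

/-- On `Y` the heads of a vector converge to it in norm, so nothing remains in the limit. -/
theorem limProj_mem_annihilator (φ : StrongDual 𝕜 (SpaceX 𝕜)) :
    limProj 𝕜 φ ∈ annihilator (spaceY 𝕜) := fun y hy => by
  refine tendsto_nhds_unique (tendsto_limProj φ y) ?_
  rw [← map_zero φ]
  exact (φ.continuous.tendsto 0).comp (tendsto_headX_of_mem_spaceY hy)

theorem limProj_of_mem_annihilator {φ : StrongDual 𝕜 (SpaceX 𝕜)}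
    (hφ : φ ∈ annihilator (spaceY 𝕜)) : limProj 𝕜 φ = φ := by
  ext x
  refine tendsto_nhds_unique (tendsto_limProj φ x) ?_
  simp [hφ _ (headX_mem_spaceY _ x)]

theorem opNorm_add_opNorm_le {E : Type*} [NormedAddCommGroup E] [NormedSpace 𝕜 E]
    {f g : StrongDual 𝕜 E} {C : ℝ}
    (h : ∀ x y, ‖x‖ ≤ 1 → ‖y‖ ≤ 1 → ‖f x‖ + ‖g y‖ ≤ C) : ‖f‖ + ‖g‖ ≤ C := by
  let _ : NormedSpace ℝ E := NormedSpace.restrictScalars ℝ 𝕜 E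
  have hf (y : E) (hy : ‖y‖ ≤ 1) : ‖f‖ ≤ C - ‖g y‖ :=
    ContinuousLinearMap.opNorm_le_of_unit_norm
      (by simpa using h 0 y (by simp) hy) fun x hx => by linarith [h x y hx.le hy]
  have hg : ‖g‖ ≤ C - ‖f‖ :=
    ContinuousLinearMap.opNorm_le_of_unit_norm
      (by simpa using hf 0 (by simp)) fun y hy => by linarith [hf y hy.le]
  linarith

/-- The summable part sees only heads and the limit part only tails, so the two may be tested on
independent vectors. -/
theorem norm_sumProj_add_norm_limProj_le (φ : StrongDual 𝕜 (SpaceX 𝕜)) :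
    ‖limProj 𝕜 φ‖ + ‖sumProj 𝕜 φ‖ ≤ ‖φ‖ := by
  refine opNorm_add_opNorm_le fun y x hy hx => ?_
  obtain ⟨s, hs1, hs⟩ := exists_rotation (sumProj 𝕜 φ x)
  obtain ⟨t, ht1, ht⟩ := exists_rotation (limProj 𝕜 φ y)
  -- The test vector follows `x` on the first `N` places and `y` beyond them, so it stays in the
  -- unit ball; `s` and `t` align the two values.
  have hlim : Tendsto (fun N => φ (s • headX 𝕜 N x + t • (y - headX 𝕜 N y))) atTop
      (𝓝 (((‖limProj 𝕜 φ y‖ + ‖sumProj 𝕜 φ x‖ : ℝ)) : 𝕜)) := by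
    rw [RCLike.ofReal_add, ← hs, ← ht, add_comm]
    simp only [map_add, map_smul, smul_eq_mul]
    exact ((tendsto_sumProj φ x).const_mul s).add ((tendsto_limProj φ y).const_mul t)
  have hle := le_of_tendsto hlim.norm (Eventually.of_forall fun N =>
    φ.le_opNorm_of_le (c := 1) ((norm_spaceX_le_iff zero_le_one).2 fun i m => ?_))
  · rw [RCLike.norm_ofReal, mul_one] at hle
    exact (le_abs_self _).trans hle
  · simp only [map_add, map_smul, map_sub, coordX_headX, smul_eq_mul]
    split_ifs
    · simpa [hs1] using (norm_coordX_le i m x).trans hx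
    · simpa [ht1] using (norm_coordX_le i m y).trans hy

theorem isLprojection_limProj : IsLprojection (StrongDual 𝕜 (SpaceX 𝕜)) (limProj 𝕜) where
  proj := ContinuousLinearMap.ext fun φ => limProj_of_mem_annihilator (limProj_mem_annihilator φ)
  Lnorm φ := by
    have h : (1 - limProj 𝕜) • φ = sumProj 𝕜 φ := by
      change φ - (φ - sumProj 𝕜 φ) = _
      exact sub_sub_cancel _ _
    rw [h]
    refine le_antisymm ?_ (norm_sumProj_add_norm_limProj_le φ)
    have : φ = limProj 𝕜 φ + sumProj 𝕜 φ := by simp [limProj]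
    conv_lhs => rw [this]
    exact norm_add_le _ _

theorem isLSummand_annihilator_spaceY : IsLSummand (annihilator (spaceY 𝕜)) := by
  refine ⟨limProj 𝕜, isLprojection_limProj, le_antisymm ?_ fun φ hφ =>
    ⟨φ, limProj_of_mem_annihilator hφ⟩⟩
  rintro _ ⟨φ, rfl⟩
  exact limProj_mem_annihilator φ

end Projection

/-! ### Numerical index of `X*` -/

section DualIndex

variable {𝕜 : Type*} [RCLike 𝕜]

variable (𝕜) in
/-- The operator of `X` that rotates the limits. -/
def rotX : SpaceX 𝕜 →L[𝕜] SpaceX 𝕜 := constX 𝕜 ∘L rotH 𝕜 ∘L limHex 𝕜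

variable (𝕜) in
/-- The operator of `X*` that rotates the part of a functional in the annihilator of `Y`. -/
def rotDual : StrongDual 𝕜 (SpaceX 𝕜) →L[𝕜] StrongDual 𝕜 (SpaceX 𝕜) :=
  (ContinuousLinearMap.compL 𝕜 (SpaceX 𝕜) (SpaceX 𝕜) 𝕜).flip (rotX 𝕜) ∘L limProj 𝕜

theorem rotDual_apply (φ : StrongDual 𝕜 (SpaceX 𝕜)) (x : SpaceX 𝕜) :
    rotDual 𝕜 φ x = limProj 𝕜 φ (constX 𝕜 (rotH 𝕜 (limHex 𝕜 x))) :=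
  rfl

theorem norm_limProj_le (φ : StrongDual 𝕜 (SpaceX 𝕜)) : ‖limProj 𝕜 φ‖ ≤ ‖φ‖ := by
  linarith [norm_sumProj_add_norm_limProj_le φ, norm_nonneg (sumProj 𝕜 φ)]

theorem norm_limX_functional_le (i : Fin 3) : ‖limX 𝕜 i‖ ≤ 1 :=
  ContinuousLinearMap.opNorm_le_bound _ zero_le_one fun x => by simpa using norm_limX_le i x

theorem limX_mem_annihilator (i : Fin 3) : limX 𝕜 i ∈ annihilator (spaceY 𝕜) :=
  fun _ hy => mem_spaceY.1 hy i

theorem norm_rotDual : ‖rotDual 𝕜‖ = 1 := by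
  refine le_antisymm (ContinuousLinearMap.opNorm_le_bound _ zero_le_one fun φ =>
    ContinuousLinearMap.opNorm_le_bound _ (by positivity) fun x => ?_) ?_
  · rw [one_mul, rotDual_apply]
    refine ((limProj 𝕜 φ).le_opNorm_of_le ((norm_constX_le _).trans
      ((norm_rotH_le _).trans (norm_limHex_le x)))).trans ?_
    gcongr
    exact norm_limProj_le φ
  -- The norm is attained by the first limit, tested on the constant triple `(0, 1, -1)`.
  · have h1 : rotDual 𝕜 (limX 𝕜 0) (constX 𝕜 (edgeH 𝕜)) = 1 := by
      rw [rotDual_apply, limProj_of_mem_annihilator (limX_mem_annihilator 0), limX_constX,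
        limHex_constX, coordH_zero_rotH_edgeH]
    have h2 := (rotDual 𝕜 (limX 𝕜 0)).le_of_opNorm_le_of_le
      ((rotDual 𝕜).le_opNorm_of_le (norm_limX_functional_le 0))
      ((norm_constX_le (edgeH 𝕜)).trans norm_edgeH_le)
    simpa [h1] using h2

/-- Functionals vanishing on `Y` are combinations of the three limits without increasing the
norm. -/
theorem exists_coeff_of_mem_annihilator {ψ : StrongDual 𝕜 (SpaceX 𝕜)}
    (hψ : ψ ∈ annihilator (spaceY 𝕜)) :
    ∃ α : Fin 3 → 𝕜, (∀ h, ψ (constX 𝕜 h) = ∑ i, α i * coordH 𝕜 i h) ∧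
      ψ = ∑ i, α i • limX 𝕜 i ∧ ∑ i, ‖α i‖ ≤ ‖ψ‖ := by
  obtain ⟨α, hα, hn⟩ := exists_coeff_hexSpace (ψ ∘L constX 𝕜)
  refine ⟨α, hα, ?_, hn.trans ?_⟩
  · ext x
    rw [apply_eq_of_mem_annihilator hψ]
    exact (hα _).trans (by simp)
  · refine ContinuousLinearMap.opNorm_le_bound _ (norm_nonneg _) fun h => ?_
    exact ψ.le_opNorm_of_le (norm_constX_le h)

theorem numericalIndex_dual_lt_one : numericalIndex 𝕜 (StrongDual 𝕜 (SpaceX 𝕜)) < 1 := by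
  refine ((numericalIndex_le (norm_rotDual (𝕜 := 𝕜))).trans
    (numericalRadius_le (by positivity) ?_)).trans_lt sqrt_three_div_two_lt_one
  rintro _ ⟨φ, F, hφ, hF, hFφ, rfl⟩
  obtain ⟨α, hα, hψ, hn⟩ := exists_coeff_of_mem_annihilator (limProj_mem_annihilator φ)
  have hnorm := norm_sumProj_add_norm_limProj_le φ
  have hle (ψ : StrongDual 𝕜 (SpaceX 𝕜)) : ‖F ψ‖ ≤ ‖ψ‖ := by simpa [hF] using F.le_opNorm ψ
  -- The two parts of `φ` have norms adding to at most 1 and values under `F` adding to 1, so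
  -- neither value can fall short of its norm.
  have hattain : ‖limProj 𝕜 φ‖ ≤ ‖F (limProj 𝕜 φ)‖ := by
    have h1 : F (limProj 𝕜 φ) + F (sumProj 𝕜 φ) = 1 := by
      rw [← map_add, ← hFφ]
      simp [limProj]
    have h2 := norm_add_le (F (limProj 𝕜 φ)) (F (sumProj 𝕜 φ))
    rw [h1, norm_one] at h2
    linarith [hle (sumProj 𝕜 φ)]
  have hS : rotDual 𝕜 φ = ∑ i, α i • (2⁻¹ : 𝕜) • (limX 𝕜 (i + 1) - limX 𝕜 (i + 2)) := by
    ext x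
    rw [rotDual_apply, hα]
    simp only [coordH_rotH, coordH_limHex, sum_apply,
      smul_apply, sub_apply, smul_eq_mul]
    refine Finset.sum_congr rfl fun i _ => by ring
  -- The limits sum to zero as functionals on `X`, so the triple `F (limX 𝕜 i)` satisfies the
  -- equation of `H`.
  have hsum : ∑ i, F (limX 𝕜 i) = 0 := by
    rw [← map_sum, ← map_zero F]
    congr 1
    ext x
    simpa using sum_limX x
  have hFψ : F (limProj 𝕜 φ) = ∑ i, α i * F (limX 𝕜 i) := by
    conv_lhs => rw [hψ]
    simp
  have hFS : F (rotDual 𝕜 φ) = ∑ i, α i * ((F (limX 𝕜 (i + 1)) - F (limX 𝕜 (i + 2))) / 2) := by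
    rw [hS]
    simp only [map_sum, map_smul, map_sub, smul_eq_mul]
    refine Finset.sum_congr rfl fun i _ => by ring
  rw [hFS]
  refine (norm_sum_rotate_le hsum
    (fun i => (hle _).trans (norm_limX_functional_le i)) ?_).trans
    (mul_le_of_le_one_right (by positivity) ?_)
  · rw [← hFψ]
    exact hn.trans hattain
  · exact hn.trans ((norm_limProj_le φ).trans hφ.le)

end DualIndex

/-! ### The quotient `X/Y` and its dual -/

section Quotient

variable {𝕜 : Type*} [RCLike 𝕜] {E : Type*} [NormedAddCommGroup E] [NormedSpace 𝕜 E]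

/-- The dual of a quotient by a closed subspace is isometric to the annihilator. -/
def dualQuotientEquiv (Y : Submodule 𝕜 E) [IsClosed (Y : Set E)] :
    StrongDual 𝕜 (E ⧸ Y) ≃ₗᵢ[𝕜] annihilator Y where
  toFun g := ⟨g ∘L Y.mkQL, fun y hy => by
    change g (Submodule.Quotient.mk y) = 0
    rw [(Submodule.Quotient.mk_eq_zero Y).2 hy, map_zero]⟩
  map_add' _ _ := rfl
  map_smul' _ _ := rfl
  invFun f := Y.liftQL f.1 fun y hy => f.2 y hy
  left_inv g := by
    ext q
    obtain ⟨x, rfl⟩ := Submodule.Quotient.mk_surjective Y q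
    rfl
  right_inv f := rfl
  norm_map' g := by
    change ‖g ∘L Y.mkQL‖ = ‖g‖
    refine le_antisymm (ContinuousLinearMap.opNorm_le_bound _ (norm_nonneg g) fun x =>
      g.le_opNorm_of_le (Submodule.Quotient.norm_mk_le Y x)) ?_
    refine ContinuousLinearMap.opNorm_le_bound _ (norm_nonneg _) fun q => ?_
    refine le_of_forall_pos_le_add fun ε hε => ?_
    set C := ‖g ∘L Y.mkQL‖
    have hC : 0 ≤ C := norm_nonneg _
    -- Dividing by `C + 1` rather than `C` allows for `C = 0`.
    obtain ⟨x, rfl, hx⟩ := Submodule.Quotient.norm_mk_lt q (ε := ε / (C + 1)) (by positivity)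
    calc ‖g (Submodule.Quotient.mk x)‖ ≤ C * ‖x‖ := (g ∘L Y.mkQL).le_opNorm x
      _ ≤ C * (‖(Submodule.Quotient.mk x : E ⧸ Y)‖ + ε / (C + 1)) := by gcongr
      _ = C * ‖(Submodule.Quotient.mk x : E ⧸ Y)‖ + C / (C + 1) * ε := by ring
      _ ≤ C * ‖(Submodule.Quotient.mk x : E ⧸ Y)‖ + ε := by
        gcongr
        exact mul_le_of_le_one_left hε.le ((div_le_one (by positivity)).2 (by linarith))

variable (𝕜) in
/-- The linear map `X/Y → H` induced by the limits. -/
def quotientLim : (SpaceX 𝕜 ⧸ spaceY 𝕜) →ₗ[𝕜] hexSpace 𝕜 :=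
  (spaceY 𝕜).liftQ (limHex 𝕜 : SpaceX 𝕜 →ₗ[𝕜] hexSpace 𝕜) fun _ hy => mem_spaceY_iff_limHex.1 hy

theorem quotientLim_mk (x : SpaceX 𝕜) :
    quotientLim 𝕜 (Submodule.Quotient.mk x) = limHex 𝕜 x :=
  rfl

theorem norm_quotientLim (q : SpaceX 𝕜 ⧸ spaceY 𝕜) : ‖quotientLim 𝕜 q‖ = ‖q‖ := by
  refine le_antisymm (le_of_forall_pos_le_add fun ε hε => ?_) ?_
  · obtain ⟨x, rfl, hx⟩ := Submodule.Quotient.norm_mk_lt q hε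
    exact (norm_limHex_le x).trans hx.le
  · obtain ⟨x, rfl⟩ := Submodule.Quotient.mk_surjective _ q
    -- The constant triple of limits is a representative of least norm in its class.
    have h : (Submodule.Quotient.mk x : SpaceX 𝕜 ⧸ spaceY 𝕜) =
        Submodule.Quotient.mk (constX 𝕜 (limHex 𝕜 x)) := by
      rw [Submodule.Quotient.eq, mem_spaceY_iff_limHex, map_sub, limHex_constX, sub_self]
    rw [quotientLim_mk, h]
    exact (Submodule.Quotient.norm_mk_le _ _).trans (norm_constX_le _)

variable (𝕜) in
/-- The limits identify `X/Y` isometrically with the hexagonal space. -/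
def quotientEquivHex : (SpaceX 𝕜 ⧸ spaceY 𝕜) ≃ₗᵢ[𝕜] hexSpace 𝕜 :=
  LinearIsometryEquiv.ofSurjective ⟨quotientLim 𝕜, norm_quotientLim⟩ fun h =>
    ⟨Submodule.Quotient.mk (constX 𝕜 h), limHex_constX h⟩

end Quotient

/-! ### Identification with `C(K)` and C-richness -/

section ContinuousFunctions

variable {𝕜 : Type*} [RCLike 𝕜]

variable (𝕜) in
/-- The restriction of a continuous function on the one-point compactification of `ℕ` to `ℕ`, as
a convergent sequence. -/
def restrictSeq : C(OnePoint ℕ, 𝕜) →ₗ[𝕜] ConvSeq 𝕜 where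
  toFun f := mkSeq (fun n => f n) (f OnePoint.infty)
    ((OnePoint.continuous_iff_from_nat f).1 f.continuous)
  map_add' _ _ := rfl
  map_smul' _ _ := rfl

theorem forall_onePoint_norm_le {f : C(OnePoint ℕ, 𝕜)} {r : ℝ} (h : ∀ n : ℕ, ‖f n‖ ≤ r)
    (t : OnePoint ℕ) : ‖f t‖ ≤ r :=
  OnePoint.denseRange_coe.induction_on t
    (isClosed_le (f.continuous.norm) continuous_const) h

theorem norm_restrictSeq_le_iff {f : C(OnePoint ℕ, 𝕜)} {r : ℝ} (hr : 0 ≤ r) :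
    ‖restrictSeq 𝕜 f‖ ≤ r ↔ ∀ t, ‖f t‖ ≤ r := by
  rw [norm_convSeq_le_iff hr]
  exact ⟨forall_onePoint_norm_le, fun h n => h n⟩

theorem restrictSeq_surjective : Function.Surjective (restrictSeq 𝕜) := fun x =>
  ⟨OnePoint.continuousMapMkNat (fun n => x.1 n) (seqLim x) (tendsto_seqLim x), rfl⟩

variable (𝕜) in
/-- The restriction map from `C(K)` to `c ⊕ c ⊕ c`. -/
def restrictTriple : C(threeNInfty, 𝕜) →ₗ[𝕜] ConvSeq 𝕜 × ConvSeq 𝕜 × ConvSeq 𝕜 where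
  toFun f := (restrictSeq 𝕜 (f.comp ⟨Sum.inl, continuous_inl⟩),
    restrictSeq 𝕜 (f.comp ⟨fun t => Sum.inr (Sum.inl t), by fun_prop⟩),
    restrictSeq 𝕜 (f.comp ⟨fun t => Sum.inr (Sum.inr t), by fun_prop⟩))
  map_add' _ _ := rfl
  map_smul' _ _ := rfl

theorem norm_restrictTriple (f : C(threeNInfty, 𝕜)) : ‖restrictTriple 𝕜 f‖ = ‖f‖ := by
  refine eq_of_forall_ge_iff fun r => ?_
  by_cases hr : 0 ≤ r
  · change max _ (max _ _) ≤ r ↔ _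
    rw [max_le_iff, max_le_iff, ContinuousMap.norm_le f hr, Sum.forall, Sum.forall]
    refine and_congr ?_ (and_congr ?_ ?_)
    all_goals exact norm_restrictSeq_le_iff hr
  · exact iff_of_false (fun h => hr ((norm_nonneg _).trans h)) fun h => hr ((norm_nonneg _).trans h)

theorem restrictTriple_surjective : Function.Surjective (restrictTriple 𝕜) := by
  rintro ⟨x, y, z⟩
  obtain ⟨f, rfl⟩ := restrictSeq_surjective x
  obtain ⟨g, rfl⟩ := restrictSeq_surjective y
  obtain ⟨h, rfl⟩ := restrictSeq_surjective z
  exact ⟨⟨Sum.elim f (Sum.elim g h),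
    f.continuous.sumElim (g.continuous.sumElim h.continuous)⟩, rfl⟩

variable (𝕜) in
/-- The identification of `c ⊕∞ c ⊕∞ c` with `C(K)`. -/
def tripleEquiv : (ConvSeq 𝕜 × ConvSeq 𝕜 × ConvSeq 𝕜) ≃ₗᵢ[𝕜] C(threeNInfty, 𝕜) :=
  (LinearIsometryEquiv.ofSurjective ⟨restrictTriple 𝕜, norm_restrictTriple⟩
    restrictTriple_surjective).symm

theorem restrictTriple_tripleEquiv (p : ConvSeq 𝕜 × ConvSeq 𝕜 × ConvSeq 𝕜) :
    restrictTriple 𝕜 (tripleEquiv 𝕜 p) = p :=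
  (tripleEquiv 𝕜).symm_apply_apply p

theorem tripleEquiv_apply (p : ConvSeq 𝕜 × ConvSeq 𝕜 × ConvSeq 𝕜) (n : ℕ) :
    tripleEquiv 𝕜 p (Sum.inl (OnePoint.some n)) = p.1.1 n ∧
      tripleEquiv 𝕜 p (Sum.inr (Sum.inl (OnePoint.some n))) = p.2.1.1 n ∧
      tripleEquiv 𝕜 p (Sum.inr (Sum.inr (OnePoint.some n))) = p.2.2.1 n := by
  have h := restrictTriple_tripleEquiv p
  exact ⟨congrArg (fun q => q.1.1 n) h, congrArg (fun q => q.2.1.1 n) h,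
    congrArg (fun q => q.2.2.1 n) h⟩

/-- The point of `K` at the `n`-th place of the `i`-th copy of `ℕ`. -/
def pointK (i : Fin 3) (n : ℕ) : threeNInfty :=
  ![Sum.inl (OnePoint.some n), Sum.inr (Sum.inl (OnePoint.some n)),
    Sum.inr (Sum.inr (OnePoint.some n))] i

theorem tripleEquiv_pointK (x : SpaceX 𝕜) (i : Fin 3) (n : ℕ) :
    tripleEquiv 𝕜 (inclX 𝕜 x) (pointK i n) = coordX 𝕜 i n x := by
  obtain ⟨h0, h1, h2⟩ := tripleEquiv_apply (inclX 𝕜 x) n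
  fin_cases i
  exacts [h0, h1, h2]

theorem isOpen_singleton_pointK (i : Fin 3) (n : ℕ) : IsOpen ({pointK i n} : Set threeNInfty) := by
  have h : IsOpen ({OnePoint.some n} : Set (OnePoint ℕ)) := by
    rw [← Set.image_singleton]
    exact OnePoint.isOpenEmbedding_coe.isOpenMap _ (isOpen_discrete _)
  fin_cases i
  · simpa [pointK] using isOpenMap_inl _ h
  · simpa [pointK] using isOpenMap_inr _ (isOpenMap_inl _ h)
  · simpa [pointK] using isOpenMap_inr _ (isOpenMap_inr _ h)

theorem exists_pointK_mem {U : Set threeNInfty} (hU : IsOpen U) (hne : U.Nonempty) :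
    ∃ i n, pointK i n ∈ U := by
  have key (f : OnePoint ℕ → threeNInfty) (hf : Continuous f) (t : OnePoint ℕ) (ht : f t ∈ U) :
      ∃ n : ℕ, f n ∈ U :=
    OnePoint.denseRange_coe.exists_mem_open (hU.preimage hf) ⟨t, ht⟩
  obtain ⟨t | t | t, ht⟩ := hne
  · exact ⟨0, key Sum.inl (by fun_prop) t ht⟩
  · exact ⟨1, key (fun t => Sum.inr (Sum.inl t)) (by fun_prop) t ht⟩
  · exact ⟨2, key (fun t => Sum.inr (Sum.inr t)) (by fun_prop) t ht⟩

/-- Both sides are continuous, as an isolated point is clopen, and they agree on the dense set of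
points `pointK`. This also settles the values at the three points at infinity. -/
theorem tripleEquiv_unitX (i : Fin 3) (n : ℕ) (t : threeNInfty) :
    tripleEquiv 𝕜 (inclX 𝕜 (unitX 𝕜 i n)) t = Set.indicator {pointK i n} 1 t := by
  have hclopen : IsClopen ({pointK i n} : Set threeNInfty) :=
    ⟨isClosed_singleton, isOpen_singleton_pointK i n⟩
  have hcont : Continuous (Set.indicator {pointK i n} (1 : threeNInfty → 𝕜)) :=
    hclopen.continuous_indicator continuous_one
  have hclosed : IsClosed {t | tripleEquiv 𝕜 (inclX 𝕜 (unitX 𝕜 i n)) t =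
      Set.indicator {pointK i n} (1 : threeNInfty → 𝕜) t} :=
    isClosed_eq (ContinuousMap.continuous _) hcont
  by_contra ht
  obtain ⟨j, m, h⟩ := exists_pointK_mem hclosed.isOpen_compl ⟨t, ht⟩
  refine h ?_
  have hinj : pointK j m = pointK i n ↔ j = i ∧ m = n := by
    fin_cases i <;> fin_cases j <;> simp [pointK]
  change tripleEquiv 𝕜 (inclX 𝕜 (unitX 𝕜 i n)) (pointK j m) = _
  rw [tripleEquiv_pointK, coordX_unitX]
  by_cases hjm : j = i ∧ m = n
  · rw [if_pos hjm, Set.indicator_of_mem (Set.mem_singleton_iff.2 (hinj.2 hjm)), Pi.one_apply]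
  · rw [if_neg hjm, Set.indicator_of_notMem fun hmem => hjm (hinj.1 (Set.mem_singleton_iff.1 hmem))]

theorem isCRich_subspaceX :
    IsCRich ((subspaceX 𝕜).map
      ((tripleEquiv 𝕜).toLinearEquiv : _ →ₗ[𝕜] C(threeNInfty, 𝕜))) := by
  refine ⟨(tripleEquiv 𝕜).toHomeomorph.isClosedMap _ isClosed_subspaceX,
    fun U hU hne ε hε => ?_⟩
  obtain ⟨i, n, hin⟩ := exists_pointK_mem hU hne
  set h := tripleEquiv 𝕜 (inclX 𝕜 (unitX 𝕜 i n)) with hdef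
  have happly : (h : threeNInfty → 𝕜) = Set.indicator {pointK i n} 1 :=
    funext (tripleEquiv_unitX i n)
  refine ⟨h, fun t => ?_, ?_, ?_, ?_⟩
  · rw [happly]
    by_cases ht : t = pointK i n
    · exact ⟨1, zero_le_one, by simp [ht]⟩
    · exact ⟨0, le_rfl, by simp [ht]⟩
  · rw [hdef, LinearIsometryEquiv.norm_map]
    have := norm_add_unitX (x := (0 : SpaceX 𝕜)) (i := i) (n := n) (b := 1) (by simp) (by simp)
    rwa [zero_add, one_smul] at this
  · rw [tsupport, happly]
    refine (closure_minimal (Set.support_indicator_subset) isClosed_singleton).trans ?_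
    simpa using hin
  · rw [Metric.infDist_zero_of_mem]
    · exact hε
    · exact ⟨inclX 𝕜 (unitX 𝕜 i n), (unitX 𝕜 i n).2, rfl⟩

end ContinuousFunctions

/-! ### Extreme points of the real hexagon -/

section Extreme

theorem mem_closedBall_hexSpace {h : hexSpace ℝ} :
    h ∈ Metric.closedBall (0 : hexSpace ℝ) 1 ↔ ∀ i, |coordH ℝ i h| ≤ 1 := by
  rw [mem_closedBall_zero_iff, norm_hexSpace_le_iff]
  rfl

/-- The points `1` and `-1` are extreme in `[-1, 1]`. -/
theorem eq_of_mem_openSegment_of_abs_eq_one {a x y : ℝ} (hx : |x| ≤ 1) (hy : |y| ≤ 1)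
    (ha : |a| = 1) (h : a ∈ openSegment ℝ x y) : x = a := by
  obtain ⟨s, t, hs, ht, hst, rfl⟩ := h
  rw [abs_le] at hx hy
  simp only [smul_eq_mul] at ha ⊢
  obtain rfl : s = 1 - t := by linarith
  rcases eq_or_eq_neg_of_abs_eq ha with h | h
  · have : t * (1 - y) ≤ 0 := by nlinarith
    nlinarith
  · nlinarith

/-- If two coordinates had modulus less than 1, raising one and lowering the other by a small `t`
would keep the sum zero and move `h` both ways inside the ball. Ranging over `i`, at least two
coordinates have modulus 1. -/
theorem exists_abs_eq_one_of_mem_extremePoints {h : hexSpace ℝ}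
    (hext : h ∈ (Metric.closedBall (0 : hexSpace ℝ) 1).extremePoints ℝ) (i : Fin 3) :
    |coordH ℝ (i + 1) h| = 1 ∨ |coordH ℝ (i + 2) h| = 1 := by
  obtain ⟨hmem, hext⟩ := hext
  rw [mem_closedBall_hexSpace] at hmem
  by_contra! hne
  have h1 := lt_of_le_of_ne (hmem (i + 1)) hne.1
  have h2 := lt_of_le_of_ne (hmem (i + 2)) hne.2
  obtain ⟨t, ht0, ht1, ht2⟩ : ∃ t : ℝ, 0 < t ∧ |coordH ℝ (i + 1) h| + t ≤ 1 ∧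
      |coordH ℝ (i + 2) h| + t ≤ 1 :=
    ⟨min (1 - |coordH ℝ (i + 1) h|) (1 - |coordH ℝ (i + 2) h|), lt_min (by linarith) (by linarith),
      by linarith [min_le_left (1 - |coordH ℝ (i + 1) h|) (1 - |coordH ℝ (i + 2) h|)],
      by linarith [min_le_right (1 - |coordH ℝ (i + 1) h|) (1 - |coordH ℝ (i + 2) h|)]⟩
  let d : hexSpace ℝ := mkH (fun j => if j = i + 1 then t else if j = i + 2 then -t else 0) (by
    fin_cases i <;> simp [Fin.sum_univ_three])
  have hd (j) : |coordH ℝ j h| + |coordH ℝ j d| ≤ 1 := by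
    rw [coordH_mkH]
    split_ifs with hj1 hj2
    · rwa [hj1, abs_of_pos ht0]
    · rwa [hj2, abs_neg, abs_of_pos ht0]
    · simpa using hmem j
  have hp : h + d ∈ Metric.closedBall (0 : hexSpace ℝ) 1 := mem_closedBall_hexSpace.2 fun j => by
    rw [map_add]
    exact (abs_add_le _ _).trans (hd j)
  have hm : h - d ∈ Metric.closedBall (0 : hexSpace ℝ) 1 := mem_closedBall_hexSpace.2 fun j => by
    rw [map_sub]
    exact (abs_sub _ _).trans (hd j)
  have hz : h + d = h := hext hp hm
    ⟨1 / 2, 1 / 2, by norm_num, by norm_num, by norm_num, by module⟩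
  have hz' := congrArg (coordH ℝ (i + 1)) (add_eq_left.1 hz)
  rw [coordH_mkH, if_pos rfl, map_zero] at hz'
  exact ht0.ne' hz'

/-- Two coordinates of modulus 1 are fixed along any segment through `h` in the ball, and the zero
sum fixes the third. -/
theorem mem_extremePoints_hexSpace {h : hexSpace ℝ} (hle : ∀ i, |coordH ℝ i h| ≤ 1)
    (hone : ∀ i, |coordH ℝ (i + 1) h| = 1 ∨ |coordH ℝ (i + 2) h| = 1) :
    h ∈ (Metric.closedBall (0 : hexSpace ℝ) 1).extremePoints ℝ := by
  refine ⟨mem_closedBall_hexSpace.2 hle, fun x hx y hy hseg => ?_⟩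
  rw [mem_closedBall_hexSpace] at hx hy
  have key (i) (hi : |coordH ℝ i h| = 1) : coordH ℝ i x = coordH ℝ i h := by
    refine eq_of_mem_openSegment_of_abs_eq_one (hx i) (hy i) hi ?_
    obtain ⟨s, t, hs, ht, hst, rfl⟩ := hseg
    exact ⟨s, t, hs, ht, hst, by rw [map_add, map_smul, map_smul]⟩
  have hsx := sum_coordH x
  have hsh := sum_coordH h
  rw [Fin.sum_univ_three] at hsx hsh
  have hone0 : |coordH ℝ 1 h| = 1 ∨ |coordH ℝ 2 h| = 1 := hone 0
  have hone1 : |coordH ℝ 2 h| = 1 ∨ |coordH ℝ 0 h| = 1 := hone 1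
  have hone2 : |coordH ℝ 0 h| = 1 ∨ |coordH ℝ 1 h| = 1 := hone 2
  have hall : coordH ℝ 0 x = coordH ℝ 0 h ∧ coordH ℝ 1 x = coordH ℝ 1 h ∧
      coordH ℝ 2 x = coordH ℝ 2 h := by
    have k0 := key 0
    have k1 := key 1
    have k2 := key 2
    grind
  refine hexSpace_ext fun i => ?_
  fin_cases i
  exacts [hall.1, hall.2.1, hall.2.2]

theorem extremePoints_hexSpace :
    (fun p : hexSpace ℝ => (p : ℝ × ℝ × ℝ)) ''
        (Metric.closedBall (0 : hexSpace ℝ) 1).extremePoints ℝ =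
      {(1, -1, 0), (-1, 1, 0), (1, 0, -1), (-1, 0, 1), (0, 1, -1), (0, -1, 1)} := by
  ext ⟨a, b, c⟩
  simp only [Set.mem_image, Set.mem_insert_iff, Set.mem_singleton_iff, Prod.mk.injEq]
  constructor
  · rintro ⟨h, hext, heq⟩
    have h0 := exists_abs_eq_one_of_mem_extremePoints hext 0
    have h1 := exists_abs_eq_one_of_mem_extremePoints hext 1
    have h2 := exists_abs_eq_one_of_mem_extremePoints hext 2
    have hle := mem_closedBall_hexSpace.1 hext.1
    have hs := sum_coordH h
    have ea : coordH ℝ 0 h = a := congrArg Prod.fst heq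
    have eb : coordH ℝ 1 h = b := congrArg (fun p => p.2.1) heq
    have ec : coordH ℝ 2 h = c := congrArg (fun p => p.2.2) heq
    have la := hle 0
    have lb := hle 1
    have lc := hle 2
    simp only [Fin.reduceAdd, zero_add, Fin.sum_univ_three, ea, eb, ec] at h0 h1 h2 hs la lb lc
    rw [abs_le] at la lb lc
    rw [abs_eq zero_le_one, abs_eq zero_le_one] at h0 h1 h2
    clear ea eb ec heq hle hext
    -- Two coordinates are `±1`; equal signs would force the third to be `∓2`, so the signs are
    -- opposite and the third is zero.
    grind (splits := 30)
  · intro h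
    have hs : a + b + c = 0 := by grind
    refine ⟨⟨(a, b, c), hs⟩, mem_extremePoints_hexSpace (fun i => ?_) (fun i => ?_), rfl⟩
    · fin_cases i
      · change |a| ≤ 1
        grind
      · change |b| ≤ 1
        grind
      · change |c| ≤ 1
        grind
    · fin_cases i
      · change |b| = 1 ∨ |c| = 1
        grind
      · change |c| = 1 ∨ |a| = 1
        grind
      · change |a| = 1 ∨ |b| = 1
        grind

end Extreme

end

end NumericalIndex

open NumericalIndex in
theorem mainTheorem1 (𝕜 : Type*) [RCLike 𝕜] :
    -- `X` is a Banach space with `n(X) = 1` and `n(X*) < 1`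
    CompleteSpace (SpaceX 𝕜) ∧
    numericalIndex 𝕜 (SpaceX 𝕜) = 1 ∧
    numericalIndex 𝕜 (StrongDual 𝕜 (SpaceX 𝕜)) < 1 ∧
    -- `X` is C-rich, under the canonical identification of `c ⊕∞ c ⊕∞ c` with `C(K)`
    (∃ Φ : (ConvSeq 𝕜 × ConvSeq 𝕜 × ConvSeq 𝕜) ≃ₗᵢ[𝕜] C(threeNInfty, 𝕜),
      (∀ p, ∀ n : ℕ,
        Φ p (Sum.inl (OnePoint.some n)) = p.1.1 n ∧
        Φ p (Sum.inr (Sum.inl (OnePoint.some n))) = p.2.1.1 n ∧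
        Φ p (Sum.inr (Sum.inr (OnePoint.some n))) = p.2.2.1 n) ∧
      IsCRich ((subspaceX 𝕜).map (Φ.toLinearEquiv : _ →ₗ[𝕜] C(threeNInfty, 𝕜)))) ∧
    -- the annihilator of `Y` is an L-summand of `X*`, and it is `(X/Y)*`
    IsLSummand (annihilator (spaceY 𝕜)) ∧
    (∃ J : StrongDual 𝕜 (SpaceX 𝕜 ⧸ spaceY 𝕜) ≃ₗᵢ[𝕜] annihilator (spaceY 𝕜),
      ∀ g x, (J g : StrongDual 𝕜 (SpaceX 𝕜)) x = g (Submodule.Quotient.mk x)) ∧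
    -- `X/Y` is the two-dimensional hexagonal space, and its numerical index is less than one
    (∃ Q : (SpaceX 𝕜 ⧸ spaceY 𝕜) ≃ₗᵢ[𝕜] hexSpace 𝕜,
      ∀ x : SpaceX 𝕜, (Q (Submodule.Quotient.mk x) : 𝕜 × 𝕜 × 𝕜) =
        (seqLim (inclX 𝕜 x).1, seqLim (inclX 𝕜 x).2.1, seqLim (inclX 𝕜 x).2.2)) ∧
    Module.finrank 𝕜 (hexSpace 𝕜) = 2 ∧
    (fun p : hexSpace ℝ => (p : ℝ × ℝ × ℝ)) ''
        (Metric.closedBall (0 : hexSpace ℝ) 1).extremePoints ℝ =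
      {(1, -1, 0), (-1, 1, 0), (1, 0, -1), (-1, 0, 1), (0, 1, -1), (0, -1, 1)} ∧
    numericalIndex 𝕜 (hexSpace 𝕜) < 1 :=
  ⟨completeSpace_spaceX, numericalIndex_spaceX, numericalIndex_dual_lt_one,
    ⟨tripleEquiv 𝕜, tripleEquiv_apply, isCRich_subspaceX⟩,
    isLSummand_annihilator_spaceY,
    ⟨dualQuotientEquiv (spaceY 𝕜), fun _ _ => rfl⟩,
    ⟨quotientEquivHex 𝕜, fun _ => rfl⟩,
    finrank_hexSpace, extremePoints_hexSpace, numericalIndex_hexSpace_lt_one⟩
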